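/- Let $k$ be an algebraically closed field of characteristic zero, let $n\ge 1$ and $d\ge 3$ be integers, and let $R=k[x_1,\ldots,x_n]$ and $S=k[y_1,\ldots,y_n]$ with their standard gradings. Let $R$ act on $S$ by differentiation, $h\circ F:=h(\partial/\partial y_1,\ldots,\partial/\partial y_n)F$, and for $F\in S$ put $\mathrm{Ann}_R(F)=\{h\in R : h\circ F=0\}$. For $f\in R_d$ let $J_f=(\partial f/\partial x_1,\ldots,\partial f/\partial x_n)$ be the gradient ideal, $M_f=R/J_f$ the Milnor algebra, and set $T=n(d-2)$. A nonzero form $g$ defines a smooth hypersurface $V(g)\subset\mathbb P_k^{n-1}$ if there is no point of $\mathbb P_k^{n-1}$ at which $g$ and all its first partial derivatives vanish. The hypersurface $V(f)$ is called Veronese-Avoiding if (I) $\operatorname{codim}_{\mathbb P(R_{T-1})}\mathbb P\big((J_f)_{T-1}\big)=n$, where this codimension means $\dim_k R_{T-1}-\dim_k (J_f)_{T-1}$; and (II) $\mathbb P\big((J_f)_{T-1}\big)\cap V_n^{T-1}=\emptyset$, where $V_n^{m}\subset\mathbb P(R_m)$ is the Veronese variety, that is, the image of $\mathbb P(R_1)\to\mathbb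 P(R_m)$, $[\ell]\mapsto[\ell^m]$. Theorem. Let $f\in R_d$ be a homogeneous polynomial of degree $d\ge 3$ defining a smooth hypersurface in $\mathbb P_k^{n-1}$, and let $F\in S_T$ be a Macaulay inverse system of $M_f$, that is, a homogeneous polynomial of degree $T=n(d-2)$ with $J_f=\mathrm{Ann}_R(F)$. Then the following are equivalent: (a) the hypersurface $V(f)$ is Veronese-Avoiding; (b) the hypersurface $V(F)\subset\mathbb P_k^{n-1}$ is smooth. -/

import Mathlib

namespace VeroneseAvoiding

open MvPolynomial
open scoped IsMulCommutative

/-- The graded piece `R_m` of the polynomial ring `R = k[x_1, …, x_n]`. -/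
abbrev gradedPiece (k : Type*) [Field k] (n m : ℕ) : Submodule k (MvPolynomial (Fin n) k) :=
  homogeneousSubmodule (Fin n) k m

section Smooth

variable {k : Type*} [Field k] {n : ℕ}

/-- `v`, a nonzero vector of homogeneous coordinates, represents a singular point of `V(f)`:
`f` and all its partial derivatives vanish at `v`. -/
def IsSingularAt (f : MvPolynomial (Fin n) k) (v : Fin n → k) : Prop :=
  eval v f = 0 ∧ ∀ i, eval v (pderiv i f) = 0

/-- The form `f` defines a smooth hypersurface `V(f)` in `ℙ^{n-1}` over an algebraically closed
field: `f` is not zero and `V(f)` has no singular point. -/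
def DefinesSmoothHypersurface (f : MvPolynomial (Fin n) k) : Prop :=
  f ≠ 0 ∧ ∀ v : Fin n → k, v ≠ 0 → ¬ IsSingularAt f v

/-- The gradient ideal `J_f = (∂f/∂x_1, …, ∂f/∂x_n)`. -/
noncomputable def gradientIdeal (f : MvPolynomial (Fin n) k) : Ideal (MvPolynomial (Fin n) k) :=
  Ideal.span (Set.range fun i => pderiv i f)

/-- The graded piece `I_m = I ∩ R_m` of an ideal `I`, as a linear subspace of `R_m`. -/
noncomputable def idealPiece (I : Ideal (MvPolynomial (Fin n) k)) (m : ℕ) :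
    Submodule k (gradedPiece k n m) :=
  (I.restrictScalars k).comap (gradedPiece k n m).subtype

end Smooth

section Projective

variable {k V : Type*} [Field k] [AddCommGroup V] [Module k V]

/-- The projective linear subspace `ℙ(W) ⊆ ℙ(V)` of a linear subspace `W ⊆ V`. -/
def projectiveSubspace (W : Submodule k V) : Set (Projectivization k V) :=
  {p | p.submodule ≤ W}

/-- The codimension of `ℙ(W)` in `ℙ(V)`, that is `dim (V / W)`
(for finite-dimensional `V`, this is `dim V - dim W`). -/
noncomputable def projectiveCodim (W : Submodule k V) : ℕ :=
  Module.finrank k (V ⧸ W)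

end Projective

section Veronese

variable (k : Type*) [Field k] (n m : ℕ)

/-- The power `ℓ ^ m ∈ R_m` of a linear form `ℓ ∈ R_1`. -/
noncomputable def linearFormPow (l : gradedPiece k n 1) : gradedPiece k n m :=
  ⟨(l : MvPolynomial (Fin n) k) ^ m, by
    have h := IsHomogeneous.pow ((mem_homogeneousSubmodule 1 _).1 l.2) m
    rw [one_mul] at h
    exact (mem_homogeneousSubmodule m _).2 h⟩

theorem linearFormPow_ne_zero {l : gradedPiece k n 1} (hl : l ≠ 0) :
    linearFormPow k n m l ≠ 0 := by
  intro h
  have h1 : (l : MvPolynomial (Fin n) k) ^ m = 0 := congrArg Subtype.val h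
  exact hl (Subtype.ext (eq_zero_of_pow_eq_zero h1))

theorem linearFormPow_smul (c : k) (l : gradedPiece k n 1) :
    linearFormPow k n m (c • l) = c ^ m • linearFormPow k n m l :=
  Subtype.ext (smul_pow c (l : MvPolynomial (Fin n) k) m)

/-- The Veronese map `ℙ(R_1) → ℙ(R_m)`, `[ℓ] ↦ [ℓ ^ m]`. -/
noncomputable def veroneseMap :
    Projectivization k (gradedPiece k n 1) → Projectivization k (gradedPiece k n m) :=
  Projectivization.lift
    (fun l => Projectivization.mk k (linearFormPow k n m l.1) (linearFormPow_ne_zero k n m l.2))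
    (by
      rintro ⟨a, ha⟩ ⟨b, hb⟩ t h
      have h' : a = t • b := h
      have ht : t ≠ 0 := by
        rintro rfl
        exact ha (by rw [h', zero_smul])
      refine (Projectivization.mk_eq_mk_iff' k _ _ _ _).2 ⟨t ^ m, ?_⟩
      simp only [h', linearFormPow_smul])

/-- The Veronese variety `V_n^m ⊆ ℙ(R_m)`, the image of the Veronese map. -/
def veroneseVariety : Set (Projectivization k (gradedPiece k n m)) :=
  Set.range (veroneseMap k n m)

end Veronese

section Avoiding

variable {k : Type*} [Field k] {n : ℕ}

/-- The hypersurface `V(f)` of the degree `d` form `f` is Veronese-Avoiding: with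
`T = n (d - 2)`, the subspace `ℙ((J_f)_{T-1})` has codimension `n` in `ℙ(R_{T-1})` and does not
meet the Veronese variety `V_n^{T-1}`. -/
def IsVeroneseAvoiding (d : ℕ) (f : MvPolynomial (Fin n) k) : Prop :=
  projectiveCodim (idealPiece (gradientIdeal f) (n * (d - 2) - 1)) = n ∧
    projectiveSubspace (idealPiece (gradientIdeal f) (n * (d - 2) - 1)) ∩
      veroneseVariety k n (n * (d - 2) - 1) = ∅

end Avoiding

section Apolarity

variable (k : Type*) [Field k] (n : ℕ)

/-- The partial derivative `∂/∂y_i`, as a linear endomorphism of `S = k[y_1, …, y_n]`. -/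
noncomputable def partialOp (i : Fin n) : Module.End k (MvPolynomial (Fin n) k) :=
  (pderiv i : Derivation k (MvPolynomial (Fin n) k) (MvPolynomial (Fin n) k)).toLinearMap

theorem partialOp_comm (i j : Fin n) :
    partialOp k n i * partialOp k n j = partialOp k n j * partialOp k n i := by
  have h : ⁅(pderiv i : Derivation k (MvPolynomial (Fin n) k) (MvPolynomial (Fin n) k)),
      (pderiv j : Derivation k (MvPolynomial (Fin n) k) (MvPolynomial (Fin n) k))⁆ = 0 := by
    refine MvPolynomial.derivation_ext (R := k) fun l => ?_
    rw [Derivation.commutator_apply]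
    simp only [pderiv_X, Derivation.zero_apply, Pi.single_apply]
    split_ifs <;> simp
  refine LinearMap.ext fun p => ?_
  have hp := congrArg (fun D : Derivation k (MvPolynomial (Fin n) k) (MvPolynomial (Fin n) k) => D p) h
  rw [Derivation.commutator_apply] at hp
  exact sub_eq_zero.1 hp

/-- The algebra of constant-coefficient differential operators, generated by the `∂/∂y_i`. -/
noncomputable def constCoeffOps : Subalgebra k (Module.End k (MvPolynomial (Fin n) k)) :=
  Algebra.adjoin k (Set.range (partialOp k n))

instance : IsMulCommutative (constCoeffOps k n) :=
  Algebra.isMulCommutative_adjoin k (by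
    rintro _ ⟨i, rfl⟩ _ ⟨j, rfl⟩
    exact partialOp_comm k n i j)

/-- The substitution `h ↦ h(∂/∂y_1, …, ∂/∂y_n)`, from `R` to the linear endomorphisms of `S`. -/
noncomputable def diffOp :
    MvPolynomial (Fin n) k →ₐ[k] Module.End k (MvPolynomial (Fin n) k) :=
  (constCoeffOps k n).val.comp
    (aeval fun i => (⟨partialOp k n i, Algebra.subset_adjoin ⟨i, rfl⟩⟩ : constCoeffOps k n))

theorem diffOp_X (i : Fin n) : diffOp k n (X i) = partialOp k n i := by
  simp [diffOp]

variable {k n}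

/-- The apolar ideal `Ann_R(F) = {h ∈ R | h ∘ F = 0}`, where `h ∘ F = h(∂/∂y) F`. -/
noncomputable def apolarIdeal (F : MvPolynomial (Fin n) k) : Ideal (MvPolynomial (Fin n) k) where
  carrier := {h | diffOp k n h F = 0}
  add_mem' {a b} ha hb := by
    have ha' : diffOp k n a F = 0 := ha
    have hb' : diffOp k n b F = 0 := hb
    change diffOp k n (a + b) F = 0
    rw [map_add, LinearMap.add_apply, ha', hb', add_zero]
  zero_mem' := by
    change diffOp k n 0 F = 0
    rw [map_zero, LinearMap.zero_apply]
  smul_mem' c {a} ha := by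
    have ha' : diffOp k n a F = 0 := ha
    change diffOp k n (c * a) F = 0
    rw [map_mul, Module.End.mul_apply, ha', map_zero]

/-- `F ∈ S_T`, with `T = n (d - 2)`, is a Macaulay inverse system of the Milnor algebra
`M_f = R / J_f` of the degree `d` form `f`: `F` is homogeneous of degree `T` and
`J_f = Ann_R(F)`. -/
def IsMacaulayInverseSystem (d : ℕ) (f F : MvPolynomial (Fin n) k) : Prop :=
  F.IsHomogeneous (n * (d - 2)) ∧ gradientIdeal f = apolarIdeal F

end Apolarity

end VeroneseAvoiding

/-!
Write `T = n (d - 2) = m + 1`. Everything is read off the contraction pairing of `R_m` with the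
form `F` of degree `m + 1`, whose values `h ∘ F` are linear forms.

* The gradient ideal of `f` is generated in degree `d - 1 ≥ 2`, so it contains no nonzero linear
  form. As `J_f = Ann_R(F)`, no nonzero linear form annihilates `F`; equivalently, the first
  partial derivatives of `F` are linearly independent. If the linear forms `h ∘ F`, `h ∈ R_m`, did
  not fill `S_1`, some nonzero `ℓ ∈ R_1` would kill them all; then `R_m` kills `ℓ ∘ F ∈ S_m`, so
  `ℓ ∘ F = 0`, because the pairing `R_m × S_m → k` is perfect in characteristic zero. Hence
  `R_m / (J_f)_m ≅ S_1`, and the codimension condition always holds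
  (`projectiveCodim_idealPiece_apolarIdeal`).
* For `ℓ = ∑ a_i x_i` and `G` of degree `m` one has `ℓ ^ m ∘ G = m! G(a)`
  (`diffOp_linForm_pow`). Applied to the partial derivatives of `F` it shows that
  `ℓ ^ m ∈ Ann_R(F)` exactly when all the partial derivatives of `F` vanish at `a`, and by Euler's
  identity this says that `a` is a singular point of `V(F)`. So the powers of linear forms in
  `(J_f)_m` correspond to the singular points of `V(F)`
  (`projectiveSubspace_inter_veroneseVariety_eq_empty_iff`).
-/

namespace VeroneseAvoiding

open MvPolynomial

variable {k : Type*} [Field k] {n : ℕ}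

/-! ### Forms and their partial derivatives -/

theorem eq_C_coeff_zero_of_isHomogeneous_zero {G : MvPolynomial (Fin n) k}
    (hG : G.IsHomogeneous 0) : G = C (coeff 0 G) :=
  totalDegree_eq_zero_iff_eq_C.1 ((totalDegree_zero_iff_isHomogeneous _).2 hG)

theorem eq_zero_of_pderiv_eq_zero [CharZero k] {G : MvPolynomial (Fin n) k} {m : ℕ}
    (hG : G.IsHomogeneous (m + 1)) (h : ∀ i, pderiv i G = 0) : G = 0 := by
  have e := hG.sum_X_mul_pderiv
  simp only [h, mul_zero, Finset.sum_const_zero] at e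
  exact (smul_eq_zero.1 e.symm).resolve_left (Nat.succ_ne_zero m)

theorem sum_mul_eval_pderiv {G : MvPolynomial (Fin n) k} {m : ℕ}
    (hG : G.IsHomogeneous m) (a : Fin n → k) :
    ∑ i, a i * eval a (pderiv i G) = m * eval a G := by
  simpa using congrArg (eval a) hG.sum_X_mul_pderiv

theorem isSingularAt_iff [CharZero k] {G : MvPolynomial (Fin n) k} {m : ℕ}
    (hG : G.IsHomogeneous (m + 1)) (a : Fin n → k) :
    IsSingularAt G a ↔ ∀ i, eval a (pderiv i G) = 0 := by
  refine ⟨fun h => h.2, fun h => ⟨?_, h⟩⟩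
  have e := sum_mul_eval_pderiv hG a
  simp only [h, mul_zero, Finset.sum_const_zero] at e
  exact (mul_eq_zero.1 e.symm).resolve_left (Nat.cast_ne_zero.2 (Nat.succ_ne_zero m))

/-- The linear form `∑ a_i x_i` with coefficient vector `a`. -/
noncomputable def linForm (a : Fin n → k) : MvPolynomial (Fin n) k :=
  ∑ i, C (a i) * X i

theorem linForm_isHomogeneous (a : Fin n → k) : (linForm a).IsHomogeneous 1 :=
  IsHomogeneous.sum _ _ _ fun i _ => by
    simpa using (isHomogeneous_C (Fin n) (a i)).mul (isHomogeneous_X k i)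

theorem coeff_linForm (a : Fin n → k) (i : Fin n) :
    coeff (Finsupp.single i 1) (linForm a) = a i := by
  simp [linForm, coeff_sum, coeff_C_mul, coeff_X, Finsupp.single_left_inj, Finset.sum_ite_eq']

theorem linForm_eq_zero_iff (a : Fin n → k) : linForm a = 0 ↔ a = 0 := by
  refine ⟨fun h => funext fun i => ?_, fun h => by simp [h, linForm]⟩
  rw [← coeff_linForm a i, h, coeff_zero, Pi.zero_apply]

theorem exists_eq_linForm {h : MvPolynomial (Fin n) k} (hh : h.IsHomogeneous 1) :
    ∃ a : Fin n → k, h = linForm a := by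
  refine ⟨fun i => coeff 0 (pderiv i h), ?_⟩
  have e := hh.sum_X_mul_pderiv
  rw [one_smul] at e
  rw [← e, linForm]
  refine Finset.sum_congr rfl fun i _ => ?_
  rw [e, mul_comm, ← eq_C_coeff_zero_of_isHomogeneous_zero hh.pderiv]

/-! ### Constant-coefficient differential operators -/

theorem diffOp_X_apply (i : Fin n) (G : MvPolynomial (Fin n) k) :
    diffOp k n (X i) G = pderiv i G := by
  rw [diffOp_X]; rfl

theorem diffOp_C_apply (c : k) (G : MvPolynomial (Fin n) k) :
    diffOp k n (C c) G = c • G := by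
  rw [← algebraMap_eq, AlgHom.commutes]; rfl

theorem diffOp_mul_apply (p q G : MvPolynomial (Fin n) k) :
    diffOp k n (p * q) G = diffOp k n p (diffOp k n q G) := by
  rw [map_mul, Module.End.mul_apply]

theorem diffOp_comm (p q G : MvPolynomial (Fin n) k) :
    diffOp k n p (diffOp k n q G) = diffOp k n q (diffOp k n p G) := by
  rw [← diffOp_mul_apply, mul_comm, diffOp_mul_apply]

theorem pderiv_diffOp (i : Fin n) (h G : MvPolynomial (Fin n) k) :
    pderiv i (diffOp k n h G) = diffOp k n h (pderiv i G) := by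
  rw [← diffOp_X_apply, diffOp_comm, diffOp_X_apply]

theorem diffOp_linForm_apply (a : Fin n → k) (G : MvPolynomial (Fin n) k) :
    diffOp k n (linForm a) G = ∑ i, a i • pderiv i G := by
  simp only [linForm, map_sum, LinearMap.sum_apply, diffOp_mul_apply, diffOp_C_apply,
    diffOp_X_apply]

theorem mem_apolarIdeal {h F : MvPolynomial (Fin n) k} :
    h ∈ apolarIdeal F ↔ diffOp k n h F = 0 := Iff.rfl

theorem diffOp_monomial_isHomogeneous (s : Fin n →₀ ℕ) (c : k) (b : ℕ)
    (G : MvPolynomial (Fin n) k) (hG : G.IsHomogeneous (s.degree + b)) :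
    (diffOp k n (monomial s c) G).IsHomogeneous b := by
  induction s using Finsupp.induction_linear generalizing c b G with
  | zero =>
    rw [← C_apply, diffOp_C_apply, smul_eq_C_mul]
    simpa using (isHomogeneous_C (Fin n) c).mul hG
  | add s t hs ht =>
    rw [← mul_one c, ← monomial_mul, diffOp_mul_apply]
    refine hs c b _ (ht 1 _ _ ?_)
    rwa [map_add, add_comm s.degree, add_assoc] at hG
  | single i r =>
    rw [← mul_one c, ← C_mul_monomial, ← X_pow_eq_monomial, diffOp_mul_apply, diffOp_C_apply,
      smul_eq_C_mul]
    rw [Finsupp.degree_single] at hG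
    suffices (diffOp k n (X i ^ r) G).IsHomogeneous b by
      simpa using (isHomogeneous_C (Fin n) c).mul this
    induction r generalizing G with
    | zero => simpa using hG
    | succ r ih =>
      rw [pow_succ, diffOp_mul_apply, diffOp_X_apply]
      refine ih _ ?_
      have := hG.pderiv (i := i)
      rwa [show r + 1 + b - 1 = r + b by omega] at this

theorem diffOp_isHomogeneous {h G : MvPolynomial (Fin n) k} {m b : ℕ}
    (hh : h.IsHomogeneous m) (hG : G.IsHomogeneous (m + b)) :
    (diffOp k n h G).IsHomogeneous b := by
  rw [h.as_sum, map_sum, LinearMap.sum_apply]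
  refine IsHomogeneous.sum _ _ _ fun s hs => diffOp_monomial_isHomogeneous s _ b G ?_
  rwa [show s.degree = m by
    by_contra hne
    exact mem_support_iff.1 hs (hh.coeff_eq_zero hne)]

/-- Nondegeneracy of the contraction pairing `R_m × S_m → k` on the right. -/
theorem eq_zero_of_forall_diffOp_eq_zero [CharZero k] {m : ℕ} {G : MvPolynomial (Fin n) k}
    (hG : G.IsHomogeneous m)
    (h : ∀ p : MvPolynomial (Fin n) k, p.IsHomogeneous m → diffOp k n p G = 0) : G = 0 := by
  induction m generalizing G with
  | zero => simpa using h 1 (isHomogeneous_one _ _)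
  | succ m ih =>
    refine eq_zero_of_pderiv_eq_zero hG fun i => ih hG.pderiv fun p hp => ?_
    rw [← diffOp_X_apply, ← diffOp_mul_apply]
    exact h _ (hp.mul (isHomogeneous_X k i))

theorem diffOp_linForm_pow (a : Fin n → k) {m : ℕ} {G : MvPolynomial (Fin n) k}
    (hG : G.IsHomogeneous m) :
    diffOp k n (linForm a ^ m) G = C (m.factorial * eval a G) := by
  induction m generalizing G with
  | zero =>
    rw [eq_C_coeff_zero_of_isHomogeneous_zero hG]
    simp
  | succ m ih =>
    rw [pow_succ, diffOp_mul_apply, diffOp_linForm_apply, map_sum]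
    simp only [map_smul]
    have hterm (i : Fin n) : a i • diffOp k n (linForm a ^ m) (pderiv i G) =
        C (m.factorial * (a i * eval a (pderiv i G))) := by
      rw [ih hG.pderiv, smul_eq_C_mul, ← C_mul, mul_left_comm]
    simp only [hterm]
    rw [← map_sum C, ← Finset.mul_sum, sum_mul_eval_pderiv hG, Nat.factorial_succ]
    push_cast
    ring_nf

/-! ### Linear forms in the gradient ideal -/

theorem coeff_eq_zero_of_mem_gradientIdeal {d : ℕ} {f : MvPolynomial (Fin n) k}
    (hf : f.IsHomogeneous d) {p : MvPolynomial (Fin n) k} (hp : p ∈ gradientIdeal f)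
    {s : Fin n →₀ ℕ} (hs : s.degree < d - 1) : coeff s p = 0 := by
  classical
  rw [gradientIdeal] at hp
  induction hp using Submodule.span_induction generalizing s with
  | mem x hx =>
    obtain ⟨i, rfl⟩ := hx
    exact hf.pderiv.coeff_eq_zero hs.ne
  | zero => exact coeff_zero s
  | add x y _ _ hx hy => rw [coeff_add, hx hs, hy hs, add_zero]
  | smul c x _ hx =>
    rw [smul_eq_mul, coeff_mul]
    refine Finset.sum_eq_zero fun u hu => ?_
    have hu' := congrArg Finsupp.degree (Finset.HasAntidiagonal.mem_antidiagonal.1 hu)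
    rw [map_add] at hu'
    rw [hx (by omega), mul_zero]

theorem eq_zero_of_linForm_mem_gradientIdeal {d : ℕ} (hd : 3 ≤ d) {f : MvPolynomial (Fin n) k}
    (hf : f.IsHomogeneous d) {a : Fin n → k} (ha : linForm a ∈ gradientIdeal f) : a = 0 := by
  funext i
  rw [← coeff_linForm a i]
  exact coeff_eq_zero_of_mem_gradientIdeal hf ha (by rw [Finsupp.degree_single]; omega)

/-! ### The codimension of a graded piece of an apolar ideal -/

/-- The linear map `h ↦ h ∘ F` from `R_m` to linear forms, for `F` of degree `m + 1`, where a
linear form is recorded by its coefficient vector: its `i`-th entry is the constant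
`∂/∂y_i (h ∘ F)`. -/
noncomputable def contraction (m : ℕ) (F : MvPolynomial (Fin n) k) :
    gradedPiece k n m →ₗ[k] (Fin n → k) :=
  LinearMap.pi fun i => lcoeff k 0 ∘ₗ (pderiv i).toLinearMap ∘ₗ
    (LinearMap.applyₗ F ∘ₗ (diffOp k n).toLinearMap) ∘ₗ (gradedPiece k n m).subtype

theorem contraction_apply (m : ℕ) (F : MvPolynomial (Fin n) k) (h : gradedPiece k n m)
    (i : Fin n) : contraction m F h i = coeff 0 (pderiv i (diffOp k n h.1 F)) := rfl

theorem ker_contraction [CharZero k] {m : ℕ} {F : MvPolynomial (Fin n) k}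
    (hF : F.IsHomogeneous (m + 1)) :
    LinearMap.ker (contraction m F) = idealPiece (apolarIdeal F) m := by
  ext h
  have hl : (diffOp k n h.1 F).IsHomogeneous 1 := diffOp_isHomogeneous h.2 hF
  change contraction m F h = 0 ↔ diffOp k n h.1 F = 0
  refine ⟨fun e => eq_zero_of_pderiv_eq_zero hl fun i => ?_, fun e => funext fun i => ?_⟩
  · rw [eq_C_coeff_zero_of_isHomogeneous_zero hl.pderiv, ← contraction_apply, e, Pi.zero_apply,
      map_zero]
  · rw [contraction_apply, e, map_zero, coeff_zero, Pi.zero_apply]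

theorem contraction_surjective [CharZero k] {m : ℕ} {F : MvPolynomial (Fin n) k}
    (hF : F.IsHomogeneous (m + 1)) (hlin : ∀ a : Fin n → k, linForm a ∈ apolarIdeal F → a = 0) :
    Function.Surjective (contraction m F) := by
  rw [← LinearMap.range_eq_top]
  by_contra hne
  obtain ⟨φ, hφ, hker⟩ := Submodule.exists_le_ker_of_lt_top _ (lt_top_iff_ne_top.2 hne)
  -- The functional `φ` on coefficient vectors is contraction with the linear form `linForm a`.
  let a : Fin n → k := fun i => φ (Pi.single i 1)
  have hφa (v : Fin n → k) : φ v = ∑ i, a i * v i := by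
    conv_lhs => rw [pi_eq_sum_univ' v, map_sum]
    refine Finset.sum_congr rfl fun i _ => ?_
    rw [map_smul, smul_eq_mul, mul_comm]
  have hzero : a = 0 := by
    refine hlin a (mem_apolarIdeal.2 ?_)
    have hG : (diffOp k n (linForm a) F).IsHomogeneous m :=
      diffOp_isHomogeneous (linForm_isHomogeneous a) (add_comm m 1 ▸ hF)
    refine eq_zero_of_forall_diffOp_eq_zero hG fun p hp => ?_
    rw [eq_C_coeff_zero_of_isHomogeneous_zero (diffOp_isHomogeneous (b := 0) hp hG), diffOp_comm,
      diffOp_linForm_apply, coeff_sum]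
    have hv : φ (contraction m F ⟨p, hp⟩) = 0 := hker ⟨_, rfl⟩
    rw [hφa] at hv
    simp only [coeff_smul, smul_eq_mul]
    rw [← map_zero C, ← hv]
    rfl
  refine hφ (LinearMap.ext fun v => ?_)
  rw [hφa, hzero]
  simp

theorem projectiveCodim_idealPiece_apolarIdeal [CharZero k] {m : ℕ} {F : MvPolynomial (Fin n) k}
    (hF : F.IsHomogeneous (m + 1)) (hlin : ∀ a : Fin n → k, linForm a ∈ apolarIdeal F → a = 0) :
    projectiveCodim (idealPiece (apolarIdeal F) m) = n := by
  rw [projectiveCodim, ← ker_contraction hF,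
    ((contraction m F).quotKerEquivOfSurjective (contraction_surjective hF hlin)).finrank_eq,
    Module.finrank_fin_fun]

/-! ### Powers of linear forms in an apolar ideal -/

theorem linForm_pow_mem_apolarIdeal_iff [CharZero k] {m : ℕ} {F : MvPolynomial (Fin n) k}
    (hF : F.IsHomogeneous (m + 1)) (a : Fin n → k) :
    linForm a ^ m ∈ apolarIdeal F ↔ IsSingularAt F a := by
  have hpow : (linForm a ^ m).IsHomogeneous m := by
    simpa using (linForm_isHomogeneous a).pow m
  have hl : (diffOp k n (linForm a ^ m) F).IsHomogeneous 1 := diffOp_isHomogeneous hpow hF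
  have key (i : Fin n) : pderiv i (diffOp k n (linForm a ^ m) F) =
      C (m.factorial * eval a (pderiv i F)) := by
    rw [pderiv_diffOp]
    exact diffOp_linForm_pow a hF.pderiv
  have hm : (m.factorial : k) ≠ 0 := Nat.cast_ne_zero.2 m.factorial_ne_zero
  rw [isSingularAt_iff hF, mem_apolarIdeal]
  refine ⟨fun e i => ?_, fun e => eq_zero_of_pderiv_eq_zero hl fun i => ?_⟩
  · have hi := key i
    rw [e, map_zero] at hi
    exact (mul_eq_zero.1 (C_eq_zero.1 hi.symm)).resolve_left hm
  · rw [key, e, mul_zero, map_zero]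

theorem veroneseMap_mem_projectiveSubspace_iff {m : ℕ} (I : Ideal (MvPolynomial (Fin n) k))
    {l : gradedPiece k n 1} (hl : l ≠ 0) :
    veroneseMap k n m (Projectivization.mk k l hl) ∈ projectiveSubspace (idealPiece I m) ↔
      (l : MvPolynomial (Fin n) k) ^ m ∈ I := by
  change (Projectivization.mk k (linearFormPow k n m l)
    (linearFormPow_ne_zero k n m hl)).submodule ≤ _ ↔ _
  rw [Projectivization.submodule_mk, Submodule.span_singleton_le_iff_mem]
  rfl

theorem projectiveSubspace_inter_veroneseVariety_eq_empty_iff [CharZero k] {m : ℕ}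
    {F : MvPolynomial (Fin n) k} (hF : F.IsHomogeneous (m + 1)) :
    projectiveSubspace (idealPiece (apolarIdeal F) m) ∩ veroneseVariety k n m = ∅ ↔
      ∀ v : Fin n → k, v ≠ 0 → ¬ IsSingularAt F v := by
  rw [Set.eq_empty_iff_forall_notMem]
  constructor
  · intro h v hv hsing
    let l : gradedPiece k n 1 := ⟨linForm v, linForm_isHomogeneous v⟩
    have hl : l ≠ 0 := fun e => hv ((linForm_eq_zero_iff v).1 (congrArg Subtype.val e))
    refine h (veroneseMap k n m (Projectivization.mk k l hl)) ⟨?_, _, rfl⟩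
    exact (veroneseMap_mem_projectiveSubspace_iff _ hl).2
      ((linForm_pow_mem_apolarIdeal_iff hF v).2 hsing)
  · rintro h _ ⟨hp, q, rfl⟩
    induction q using Projectivization.ind with
    | h l hl =>
      rw [veroneseMap_mem_projectiveSubspace_iff] at hp
      obtain ⟨a, ha⟩ := exists_eq_linForm l.2
      rw [ha, linForm_pow_mem_apolarIdeal_iff hF] at hp
      refine h a (fun e => hl (Subtype.ext ?_)) hp
      rw [ha, e, (linForm_eq_zero_iff 0).2 rfl]
      rfl

end VeroneseAvoiding

/-! ### Smoothness of the Macaulay inverse system -/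

open VeroneseAvoiding MvPolynomial

theorem mainTheorem2 {k : Type*} [Field k] [IsAlgClosed k] [CharZero k] (n d : ℕ) (hd : 3 ≤ d)
    (f : MvPolynomial (Fin n) k) (hf : f.IsHomogeneous d)
    (hsmooth : VeroneseAvoiding.DefinesSmoothHypersurface f)
    (F : MvPolynomial (Fin n) k) (hF : VeroneseAvoiding.IsMacaulayInverseSystem d f F) :
    VeroneseAvoiding.IsVeroneseAvoiding d f ↔ VeroneseAvoiding.DefinesSmoothHypersurface F := by
  obtain ⟨hFhom, hJ⟩ := hF
  -- Without variables there is no nonzero form of positive degree.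
  have hn : n ≠ 0 := by
    rintro rfl
    refine hsmooth.1 ((f.eq_C_of_isEmpty).trans ?_)
    rw [hf.coeff_eq_zero (by rw [map_zero]; omega), map_zero]
  obtain ⟨m, hm⟩ := Nat.exists_eq_succ_of_ne_zero
    (Nat.mul_ne_zero hn (by omega : d - 2 ≠ 0))
  rw [hm] at hFhom
  have hlin (a : Fin n → k) (ha : linForm a ∈ apolarIdeal F) : a = 0 :=
    eq_zero_of_linForm_mem_gradientIdeal hd hf (hJ ▸ ha)
  -- Otherwise `Ann_R(F)` would be the unit ideal, while no nonzero constant lies in `J_f`.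
  have hF0 : F ≠ 0 := by
    rintro rfl
    have h1 : (1 : MvPolynomial (Fin n) k) ∈ gradientIdeal f := by
      rw [hJ, mem_apolarIdeal, map_zero]
    have := coeff_eq_zero_of_mem_gradientIdeal hf h1 (s := 0) (by rw [map_zero]; omega)
    simp at this
  rw [IsVeroneseAvoiding, DefinesSmoothHypersurface, hm, hJ, Nat.succ_sub_one,
    projectiveSubspace_inter_veroneseVariety_eq_empty_iff hFhom]
  exact and_congr
    (iff_of_true (projectiveCodim_idealPiece_apolarIdeal hFhom hlin) hF0) Iff.rfl
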